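/- Let $W=\mathbb R^\ell$ and let $\mathcal A$ be a central, essential arrangement of finitely many (distinct) linear hyperplanes in $W$: the intersection of the hyperplanes is $\{0\}$. For each $H\in\mathcal A$ fix a linear form $f_H\in W^*$ with kernel $H$. A face $F$ of $\mathcal A$ is a nonempty set of the form $\{x\in W : \operatorname{sign} f_H(x)=F_H \text{ for all } H\in\mathcal A\}$, where $F_H\in\{0,+1,-1\}$. The product $FG$ of two faces is the face with $(FG)_H=F_H$ if $F_H\ne 0$ and $(FG)_H=G_H$ otherwise. Let $$Z_{\mathcal A}=\sum_{H\in\mathcal A}[-f_H,f_H]\subseteq W^*$$ be the zonotope of $\mathcal A$ (a Minkowski sum of segments), and for a face $F$ let $\hat F$ be the corresponding face of $Z_{\mathcal A}$ under its outer normal fan, i.e. the set of points of $Z_{\mathcal A}$ at which every $x\in F$, regarded as a linear functional on $W^*$, attains its maximum over $Z_{\mathcal A}$. For each face $F$ of $\mathcal A$ there is a piecewise-linear retraction $p_F$ of $Z_{\mathcal A}$ onto $\hat F$ (a continuous map $Z_{\mathcal A}\to\hat F$ that fixes $\hat F$ pointwise and is affine on each of finitely many convex polytopes with union $Z_{\mathcal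 A}$) such that $$p_F(\hat G)=\widehat{FG}\qquad\text{for every face } G \text{ of } \mathcal A .$$ Moreover, $p_F$ can be taken to be a composite of collapsing maps, as follows. For a polytope $P\subseteq W^*$ and a nonzero $v\in W^*$ let $r_{P,v}\colon P+[-v,v]\to P+v$ be the map $r_{P,v}(p)=x+v$, where $p=x+\lambda v$ with $x\in P$ and $\lambda\le 1$ maximal. List the vectors $F_Hf_H$, for the hyperplanes $H$ with $F_H\neq 0$, in any order as $v_1,\dots,v_k$; let $$P_0=\sum_{H\in\mathcal A}F_Hf_H+\sum_{H:\,F_H=0}[-f_H,f_H],\qquad P_i=P_{i-1}+[-2v_i,0]\quad(1\le i\le k).$$ Then, for every such order, the map $$r_{P_0-v_1,v_1}\circ r_{P_1-v_2,v_2}\circ\cdots\circ r_{P_{k-1}-v_k,v_k}$$ is a piecewise-linear retraction of $Z_{\mathcal A}$ onto $\hat F$ that maps $\hat G$ onto $\widehat{FG}$ for every face $G$ of $\mathcal A$. -/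

import Mathlib

open scoped Pointwise

/-- A central, essential arrangement of finitely many distinct hyperplanes in `W`, indexed by `ι`.
The hyperplane with index `i` is the kernel of the chosen nonzero linear form `form i`. -/
structure RealArrangement (ι W : Type*) [NormedAddCommGroup W] [NormedSpace ℝ W] where
  /-- the linear form defining the hyperplane -/
  form : ι → StrongDual ℝ W
  form_ne_zero : ∀ i, form i ≠ 0
  /-- the hyperplanes are pairwise distinct -/
  ker_injective : Function.Injective fun i => LinearMap.ker (form i : W →ₗ[ℝ] ℝ)
  /-- the hyperplanes intersect exactly in the origin -/
  essential : ⨅ i, LinearMap.ker (form i : W →ₗ[ℝ] ℝ) = ⊥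

namespace RealArrangement

section

variable {ι W : Type*} [NormedAddCommGroup W] [NormedSpace ℝ W]

/-- A face of the arrangement, encoded by its sign sequence; a sign sequence belongs to a face iff
it is the sign sequence of some point. -/
@[ext]
structure Face (A : RealArrangement ι W) where
  sign : ι → SignType
  realized : ∃ x : W, ∀ i, SignType.sign (A.form i x) = sign i

/-- The (relatively open) face as a set of points of `W`. -/
def Face.carrier {A : RealArrangement ι W} (F : A.Face) : Set W :=
  {x | ∀ i, SignType.sign (A.form i x) = F.sign i}

theorem Face.mul_realized [Fintype ι] {A : RealArrangement ι W} (F G : A.Face) :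
    ∃ x : W, ∀ i, SignType.sign (A.form i x)
      = if F.sign i ≠ 0 then F.sign i else G.sign i := by
  obtain ⟨x, hx⟩ := F.realized
  obtain ⟨y, hy⟩ := G.realized
  have key : ∀ i, ∀ᶠ ε : ℝ in nhdsWithin 0 (Set.Ioi 0),
      SignType.sign (A.form i (x + ε • y)) = if F.sign i ≠ 0 then F.sign i else G.sign i := by
    intro i
    have hc : Filter.Tendsto (fun ε : ℝ => A.form i (x + ε • y))
        (nhdsWithin 0 (Set.Ioi 0)) (nhds (A.form i x)) := by
      have h : Continuous fun ε : ℝ => A.form i (x + ε • y) := by fun_prop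
      have h0 := h.tendsto 0
      simp only [zero_smul, add_zero] at h0
      exact h0.mono_left nhdsWithin_le_nhds
    rcases lt_trichotomy (A.form i x) 0 with h | h | h
    · have hF : F.sign i = -1 := by rw [← hx i, sign_neg h]
      filter_upwards [hc.eventually_lt_const h] with ε hε
      rw [sign_neg hε, hF]; rfl
    · have hF : F.sign i = 0 := by rw [← hx i, h, sign_zero]
      filter_upwards [self_mem_nhdsWithin] with ε hε
      have hε' : (0 : ℝ) < ε := hε
      rw [hF, ← hy i, map_add, h, zero_add, map_smul, smul_eq_mul, sign_mul, sign_pos hε']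
      simp
    · have hF : F.sign i = 1 := by rw [← hx i, sign_pos h]
      filter_upwards [hc.eventually_const_lt h] with ε hε
      rw [sign_pos hε, hF]; rfl
  obtain ⟨ε, hε⟩ := (Filter.eventually_all.2 key).exists
  exact ⟨x + ε • y, hε⟩

/-- The face product: `(FG)_i = F_i` if `F_i ≠ 0`, and `(FG)_i = G_i` otherwise. -/
instance [Fintype ι] {A : RealArrangement ι W} : Mul A.Face where
  mul F G := ⟨fun i => if F.sign i ≠ 0 then F.sign i else G.sign i, F.mul_realized G⟩

/-- The zonotope of the arrangement: the Minkowski sum of the intervals `[-f_i, f_i]` in the dual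
space. -/
def zonotope [Fintype ι] (A : RealArrangement ι W) : Set (StrongDual ℝ W) :=
  ∑ i, segment ℝ (-A.form i) (A.form i)

/-- The face of the zonotope corresponding to the face `F` of the arrangement through the outer
normal fan: the points of the zonotope at which the vectors of `F`, as linear functionals on the
dual space, attain their maximum over the zonotope. -/
def Face.hat [Fintype ι] {A : RealArrangement ι W} (F : A.Face) : Set (StrongDual ℝ W) :=
  {z | z ∈ A.zonotope ∧ ∀ x ∈ F.carrier, ∀ z' ∈ A.zonotope, z' x ≤ z x}

/-- The generator `F_i f_i` of the zonotope, with the sign that it has on `F` (zero when the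
`i`-th hyperplane contains `F`). -/
def Face.signedForm {A : RealArrangement ι W} (F : A.Face) (i : ι) : StrongDual ℝ W :=
  (F.sign i : ℝ) • A.form i

/-- The polytope `v_F + Z_{A_X}`, where `v_F = ∑ i, F_i f_i` and `A_X` consists of the hyperplanes
that contain `F`. -/
def Face.base [Fintype ι] {A : RealArrangement ι W} (F : A.Face) : Set (StrongDual ℝ W) :=
  {∑ i, F.signedForm i} + ∑ i with F.sign i = 0, segment ℝ (-A.form i) (A.form i)

end

end RealArrangement

section

variable {E : Type*} [NormedAddCommGroup E] [NormedSpace ℝ E]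

/-- The collapsing map `r_{P,v} : P + [-v,v] → P + v`: if `t` is the largest real number `≤ 1` such
that `p = x + t v` with `x ∈ P`, then `p` is sent to `x + v`. (For `P` compact and
`p ∈ P + [-v,v]` the supremum is attained; other values of `p` are irrelevant.) -/
noncomputable def collapse (P : Set E) (v p : E) : E :=
  p - sSup {t : ℝ | t ≤ 1 ∧ p - t • v ∈ P} • v + v

/-- For `[v₁, …, v_k]`, with `P₀ = P` and `P_i = P_{i-1} + [-2 v_i, 0]`, the composite
`r_{P₀ - v₁, v₁} ∘ r_{P₁ - v₂, v₂} ∘ ⋯ ∘ r_{P_{k-1} - v_k, v_k}` of collapsing maps. -/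
noncomputable def collapseList (P : Set E) : List E → E → E
  | [] => id
  | v :: l => collapse (P + {-v}) v ∘ collapseList (P + segment ℝ (-(2 : ℝ) • v) 0) l

/-- `Q` is an intersection of finitely many closed half-spaces. -/
def IsPolyhedralSet (Q : Set E) : Prop :=
  ∃ (n : ℕ) (g : Fin n → StrongDual ℝ E) (c : Fin n → ℝ), Q = {x | ∀ k, g k x ≤ c k}

/-- `p` is piecewise linear on `Z`: it is continuous there, and `Z` is a union of finitely many
convex polyhedra on each of which `p` agrees with an affine map. -/
def IsPiecewiseLinearOn (p : E → E) (Z : Set E) : Prop :=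
  ContinuousOn p Z ∧
    ∃ (n : ℕ) (Q : Fin n → Set E), (∀ j, IsPolyhedralSet (Q j)) ∧ Z = ⋃ j, Q j ∧
      ∀ j, ∃ L : E →ᵃ[ℝ] E, Set.EqOn p L (Q j)

/-- `p` is a piecewise-linear retraction of `Z` onto the subset `K`. -/
structure IsPLRetraction (p : E → E) (Z K : Set E) : Prop where
  subset : K ⊆ Z
  mapsTo : Set.MapsTo p Z K
  fixes : ∀ z ∈ K, p z = z
  piecewiseLinear : IsPiecewiseLinearOn p Z

end

/-! ### Polyhedral sets and piecewise-linear maps -/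

section Polyhedral

variable {E : Type*} [NormedAddCommGroup E] [NormedSpace ℝ E]

/-! A collapse moves each point of `P + [-2v, 0]` in the direction `v` by the least `s ≥ 0` that
brings it into `P`. For polyhedral `P` this `s` is a maximum of finitely many affine functions, so
the collapse is a piecewise-linear retraction (`isPLRetraction_collapse`).

The key point is `collapse_image_toExposed`: for every functional `φ`, the collapse carries the
`φ`-maximal face of `P + [-2v, 0]` onto the `φ`-maximal face of `P`. Both properties survive
composition, whatever the order of the vectors. Starting from `F.base`, which is `F.hat`, the
successive sums end at the zonotope (`Face.base_add_sum`).

For `y` in `G`, the composite thus maps the `y`-maximal face of the zonotope, which is `G.hat`, onto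
the `y`-maximal face of `F.hat`. Maximal faces of Minkowski sums are computed summand by summand,
and the signs that result are those of `F * G` (`Face.toExposed_base`). -/

theorem IsPolyhedralSet.of_finite {κ : Type*} [Finite κ] (g : κ → StrongDual ℝ E) (c : κ → ℝ) :
    IsPolyhedralSet {x | ∀ k, g k x ≤ c k} := by
  obtain ⟨n, ⟨e⟩⟩ := Finite.exists_equiv_fin κ
  refine ⟨n, fun k => g (e.symm k), fun k => c (e.symm k), ?_⟩
  ext x
  exact e.forall_congr_left

theorem IsPolyhedralSet.isClosed {Q : Set E} (hQ : IsPolyhedralSet Q) : IsClosed Q := by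
  obtain ⟨n, g, c, rfl⟩ := hQ
  simp only [Set.ofPred_forall]
  exact isClosed_iInter fun k => isClosed_le (g k).continuous continuous_const

theorem IsPolyhedralSet.inter {Q R : Set E} (hQ : IsPolyhedralSet Q) (hR : IsPolyhedralSet R) :
    IsPolyhedralSet (Q ∩ R) := by
  obtain ⟨n, g, c, rfl⟩ := hQ
  obtain ⟨m, h, d, rfl⟩ := hR
  convert IsPolyhedralSet.of_finite (Sum.elim g h) (Sum.elim c d) using 1
  ext x
  simp

theorem IsPolyhedralSet.preimage_affineMap [FiniteDimensional ℝ E] {Q : Set E}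
    (hQ : IsPolyhedralSet Q) (L : E →ᵃ[ℝ] E) : IsPolyhedralSet (L ⁻¹' Q) := by
  obtain ⟨n, g, c, rfl⟩ := hQ
  refine ⟨n, fun k => (g k).comp L.linear.toContinuousLinearMap, fun k => c k - g k (L 0), ?_⟩
  ext x
  have hL : L x = L.linear x + L 0 := congrFun L.decomp x
  simp only [Set.mem_preimage, Set.mem_ofPred_eq, hL, map_add, ContinuousLinearMap.comp_apply,
    LinearMap.coe_toContinuousLinearMap', le_sub_iff_add_le]

theorem IsPolyhedralSet.singleton [FiniteDimensional ℝ E] (z : E) :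
    IsPolyhedralSet ({z} : Set E) := by
  let b := Module.finBasis ℝ E
  let g : Fin (Module.finrank ℝ E) → StrongDual ℝ E := fun k =>
    (b.coord k).toContinuousLinearMap
  convert IsPolyhedralSet.of_finite (Sum.elim g (-g))
    (Sum.elim (fun k => g k z) fun k => -g k z) using 1
  ext x
  simp only [Set.mem_singleton_iff, Set.mem_ofPred_eq, Sum.forall, Sum.elim_inl, Sum.elim_inr,
    Pi.neg_apply, neg_apply, neg_le_neg_iff]
  refine ⟨by rintro rfl; simp, fun ⟨h₁, h₂⟩ => b.ext_elem fun k => ?_⟩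
  exact le_antisymm (h₁ k) (h₂ k)

theorem exists_forall_le_and_forall_ge {κ κ' : Type*} [Finite κ] [Finite κ'] (a : κ → ℝ)
    (b : κ' → ℝ) (h : ∀ i j, a i ≤ b j) : ∃ s, (∀ i, a i ≤ s) ∧ ∀ j, s ≤ b j := by
  cases isEmpty_or_nonempty κ
  · cases isEmpty_or_nonempty κ'
    · exact ⟨0, isEmptyElim, isEmptyElim⟩
    · obtain ⟨j, hj⟩ := Finite.exists_min b
      exact ⟨b j, isEmptyElim, hj⟩
  · obtain ⟨i, hi⟩ := Finite.exists_max a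
    exact ⟨a i, hi, h i⟩

/-- Fourier–Motzkin elimination of one variable. -/
theorem IsPolyhedralSet.exists_real {κ : Type*} [Finite κ] (g : κ → StrongDual ℝ E)
    (a c : κ → ℝ) : IsPolyhedralSet {x | ∃ s : ℝ, ∀ k, g k x + a k * s ≤ c k} := by
  classical
  -- Each pair is a lower and an upper bound on `s`, combined with positive weights so that `s`
  -- cancels.
  let G : {k // a k = 0} ⊕ {k // a k < 0} × {k // 0 < a k} → StrongDual ℝ E :=
    Sum.elim (fun k => g k) fun q => a q.2 • g q.1 - a q.1 • g q.2
  let C : {k // a k = 0} ⊕ {k // a k < 0} × {k // 0 < a k} → ℝ :=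
    Sum.elim (fun k => c k) fun q => a q.2 * c q.1 - a q.1 * c q.2
  convert IsPolyhedralSet.of_finite G C using 1
  ext x
  simp only [Set.mem_ofPred_eq, Sum.forall, Prod.forall, Subtype.forall, G, C, Sum.elim_inl,
    Sum.elim_inr, sub_apply, smul_apply, smul_eq_mul]
  constructor
  · rintro ⟨s, hs⟩
    refine ⟨fun k hk => by simpa [hk] using hs k, fun k hk j hj => ?_⟩
    have h₁ := mul_le_mul_of_nonneg_left (hs k) hj.le
    have h₂ := mul_le_mul_of_nonneg_left (hs j) (neg_pos.2 hk).le
    linarith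
  · rintro ⟨h₀, h₁⟩
    obtain ⟨s, hs₁, hs₂⟩ := exists_forall_le_and_forall_ge
      (fun k : {k // a k < 0} => (g k x - c k) / -a k)
      (fun k : {k // 0 < a k} => (c k - g k x) / a k) (by
        rintro ⟨k, hk⟩ ⟨j, hj⟩
        rw [div_le_div_iff₀ (neg_pos.2 hk) hj]
        linarith [h₁ k hk j hj])
    refine ⟨s, fun k => ?_⟩
    rcases lt_trichotomy (a k) 0 with hk | hk | hk
    · have := hs₁ ⟨k, hk⟩
      rw [div_le_iff₀ (neg_pos.2 hk)] at this
      linarith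
    · simpa [hk] using h₀ k hk
    · have := hs₂ ⟨k, hk⟩
      rw [le_div_iff₀ hk] at this
      linarith

/-- The sum is the projection of a polyhedron in the pair `(x, s)`, where `s` is the parameter on
the segment. The `Bool` indices carry the constraints `0 ≤ s` and `s ≤ 1`. -/
theorem IsPolyhedralSet.add_segment {P : Set E} (hP : IsPolyhedralSet P) (u w : E) :
    IsPolyhedralSet (P + segment ℝ u w) := by
  obtain ⟨n, g, c, rfl⟩ := hP
  convert IsPolyhedralSet.exists_real (Sum.elim g (0 : Bool → StrongDual ℝ E))
    (Sum.elim (fun k => -g k (w - u)) fun b => cond b 1 (-1))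
    (Sum.elim (fun k => c k + g k u) fun b => cond b 1 0) using 1
  ext x
  simp only [segment_eq_image', Set.mem_add, Set.mem_image, Set.mem_ofPred_eq, Sum.forall,
    Sum.elim_inl, Sum.elim_inr, Bool.forall_bool, cond_true, cond_false, Set.mem_Icc,
    Pi.zero_apply, zero_apply]
  constructor
  · rintro ⟨p, hp, -, ⟨s, ⟨hs₀, hs₁⟩, rfl⟩, rfl⟩
    refine ⟨s, fun k => ?_, by linarith, by linarith⟩
    have := hp k
    simp only [map_add, map_smul, smul_eq_mul]
    linarith
  · rintro ⟨s, h, hs₀, hs₁⟩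
    refine ⟨x - (u + s • (w - u)), fun k => ?_, _, ⟨s, ⟨by linarith, by linarith⟩, rfl⟩,
      sub_add_cancel _ _⟩
    have := h k
    rw [map_sub, map_add, map_smul, smul_eq_mul]
    linarith

theorem IsPiecewiseLinearOn.of_finite [FiniteDimensional ℝ E] {κ : Type*} [Finite κ] {p : E → E}
    {Z : Set E} (Q : κ → Set E) (hQ : ∀ j, IsPolyhedralSet (Q j)) (hZ : Z = ⋃ j, Q j)
    (hp : ∀ j, ∃ L : E →ᵃ[ℝ] E, Set.EqOn p L (Q j)) : IsPiecewiseLinearOn p Z := by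
  constructor
  · rw [hZ]
    refine (locallyFinite_of_finite Q).continuousOn_iUnion (fun j => (hQ j).isClosed) fun j => ?_
    obtain ⟨L, hL⟩ := hp j
    exact L.continuous_of_finiteDimensional.continuousOn.congr hL
  · obtain ⟨n, ⟨e⟩⟩ := Finite.exists_equiv_fin κ
    exact ⟨n, fun j => Q (e.symm j), fun j => hQ _,
      hZ.trans (e.symm.surjective.iUnion_comp Q).symm, fun j => hp _⟩

/-- The cells of `p` are refined by the preimages of the cells of `q` under the affine pieces of
`p`. -/
theorem IsPiecewiseLinearOn.comp [FiniteDimensional ℝ E] {p q : E → E} {Y Z : Set E}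
    (hq : IsPiecewiseLinearOn q Y) (hp : IsPiecewiseLinearOn p Z) (h : Set.MapsTo p Z Y) :
    IsPiecewiseLinearOn (q ∘ p) Z := by
  obtain ⟨-, n, Q, hQ, hZ, hL⟩ := hp
  obtain ⟨-, m, R, hR, hY, hM⟩ := hq
  choose L hL using hL
  choose M hM using hM
  refine .of_finite (fun j : Fin n × Fin m => Q j.1 ∩ L j.1 ⁻¹' R j.2)
    (fun j => (hQ _).inter ((hR _).preimage_affineMap _)) ?_
    fun j => ⟨(M j.2).comp (L j.1), fun x hx => ?_⟩
  · ext x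
    simp only [Set.mem_iUnion, Prod.exists, Set.mem_inter_iff, Set.mem_preimage]
    constructor
    · intro hx
      obtain ⟨j, hj⟩ := Set.mem_iUnion.1 (hZ ▸ hx)
      obtain ⟨k, hk⟩ := Set.mem_iUnion.1 (hY ▸ h hx)
      exact ⟨j, k, hj, hL j hj ▸ hk⟩
    · rintro ⟨j, k, hj, -⟩
      exact hZ ▸ Set.mem_iUnion.2 ⟨j, hj⟩
  · simp only [Function.comp_apply, AffineMap.coe_comp]
    rw [hL _ hx.1, hM _ hx.2]

theorem IsPLRetraction.comp [FiniteDimensional ℝ E] {p q : E → E} {Z Y K : Set E}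
    (hq : IsPLRetraction q Y K) (hp : IsPLRetraction p Z Y) : IsPLRetraction (q ∘ p) Z K where
  subset := hq.subset.trans hp.subset
  mapsTo := hq.mapsTo.comp hp.mapsTo
  fixes z hz := by rw [Function.comp_apply, hp.fixes z (hq.subset hz), hq.fixes z hz]
  piecewiseLinear := hq.piecewiseLinear.comp hp.piecewiseLinear hp.mapsTo

end Polyhedral

/-! ### Collapsing maps and their effect on exposed faces -/

section Collapse

variable {E : Type*} [NormedAddCommGroup E] [NormedSpace ℝ E]

theorem mem_add_segment_neg_two_smul {P : Set E} {v p : E} :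
    p ∈ P + segment ℝ (-(2 : ℝ) • v) 0 ↔ ∃ s : ℝ, 0 ≤ s ∧ s ≤ 2 ∧ p + s • v ∈ P := by
  rw [segment_symm, segment_eq_image']
  simp only [Set.mem_add, Set.mem_image, Set.mem_Icc]
  constructor
  · rintro ⟨x, hx, -, ⟨t, ⟨h₀, h₁⟩, rfl⟩, rfl⟩
    refine ⟨2 * t, by linarith, by linarith, ?_⟩
    convert hx using 1
    module
  · rintro ⟨s, h₀, h₂, hs⟩
    exact ⟨_, hs, _, ⟨s / 2, ⟨by linarith, by linarith⟩, rfl⟩, by module⟩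

/-- The collapsing map pushes a point in the direction `v` until it meets the polytope. -/
theorem exists_collapse_eq {P : Set E} (hP : IsClosed P) {v p : E}
    (hp : p ∈ P + segment ℝ (-(2 : ℝ) • v) 0) :
    ∃ s : ℝ, 0 ≤ s ∧ s ≤ 2 ∧ p + s • v ∈ P ∧ (∀ s', 0 ≤ s' → p + s' • v ∈ P → s ≤ s') ∧
      collapse (P + {-v}) v p = p + s • v := by
  obtain ⟨r, hr₀, hr₂, hr⟩ := mem_add_segment_neg_two_smul.1 hp
  -- With `s = 1 - t`, the largest `t ≤ 1` becomes the least `s ≥ 0`.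
  have key : {t : ℝ | t ≤ 1 ∧ p - t • v ∈ P + {-v}} = {t : ℝ | t ≤ 1 ∧ p + (1 - t) • v ∈ P} := by
    ext t
    have : p - t • v - -v = p + (1 - t) • v := by module
    rw [Set.mem_ofPred_eq, Set.mem_ofPred_eq, Set.add_singleton, ← this]
    simp
  set T := {t : ℝ | t ≤ 1 ∧ p + (1 - t) • v ∈ P} with hT
  have hbdd : BddAbove T := ⟨1, fun t ht => ht.1⟩
  have hclosed : IsClosed T :=
    (isClosed_le continuous_id continuous_const).inter
      (hP.preimage (f := fun t : ℝ => p + (1 - t) • v) (by fun_prop))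
  have hrT : 1 - r ∈ T := ⟨by linarith, by simpa using hr⟩
  have hmem : sSup T ∈ T := hclosed.csSup_mem ⟨_, hrT⟩ hbdd
  refine ⟨1 - sSup T, by linarith [hmem.1], by linarith [le_csSup hbdd hrT], hmem.2,
    fun s' h₀ hs' => ?_, ?_⟩
  · have : 1 - s' ∈ T := ⟨by linarith, by simpa using hs'⟩
    linarith [le_csSup hbdd this]
  · rw [collapse, key]
    module

theorem collapse_add_singleton_of_mem {P : Set E} (hP : IsClosed P) {v p : E} (hp : p ∈ P) :
    collapse (P + {-v}) v p = p := by
  have hp' : p + (0 : ℝ) • v ∈ P := by simpa using hp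
  obtain ⟨s, h₀, -, -, hmin, h⟩ := exists_collapse_eq hP (v := v)
    (mem_add_segment_neg_two_smul.2 ⟨0, le_rfl, by norm_num, hp'⟩)
  have : s = 0 := le_antisymm (hmin 0 le_rfl hp') h₀
  simpa [this] using h

theorem subset_add_segment_neg_two_smul (P : Set E) (v : E) :
    P ⊆ P + segment ℝ (-(2 : ℝ) • v) 0 := fun p hp =>
  mem_add_segment_neg_two_smul.2 ⟨0, le_rfl, by norm_num, by simpa using hp⟩

/-- Only the constraints `g k ≤ c k` with `g k v < 0` force a point to move, and each demands `s ≥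
(g k x - c k) / (-g k v)`. The displacement is the maximum of these affine functions and `0`; the
cells record which one attains it. -/
theorem isPiecewiseLinearOn_collapse [FiniteDimensional ℝ E] {P : Set E} (hP : IsPolyhedralSet P)
    (v : E) : IsPiecewiseLinearOn (collapse (P + {-v}) v) (P + segment ℝ (-(2 : ℝ) • v) 0) := by
  have hclosed := hP.isClosed
  have hZ := hP.add_segment (-(2 : ℝ) • v) 0
  obtain ⟨n, g, c, hPe⟩ := hP
  -- `none` stands for the bound `0 ≤ s`.
  let κ := Option {k // g k v < 0}
  let G : κ → StrongDual ℝ E := fun k => k.elim 0 fun k => (-g k v)⁻¹ • g k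
  let C : κ → ℝ := fun k => k.elim 0 fun k => (-g k v)⁻¹ * c k
  refine .of_finite (fun j : κ => (P + segment ℝ (-(2 : ℝ) • v) 0) ∩
      {x | ∀ k, (G k - G j) x ≤ C k - C j})
    (fun j => hZ.inter (.of_finite _ _)) ?_ fun j => ?_
  · rw [← Set.inter_iUnion, eq_comm, Set.inter_eq_left]
    intro x _
    obtain ⟨j, hj⟩ := Finite.exists_max fun k => G k x - C k
    refine Set.mem_iUnion.2 ⟨j, fun k => ?_⟩
    have := hj k
    rw [sub_apply]
    linarith
  · refine ⟨AffineMap.id ℝ E + ((G j : E →ₗ[ℝ] ℝ).smulRight v).toAffineMap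
      - AffineMap.const ℝ E (C j • v), fun x ⟨hx, hj⟩ => ?_⟩
    obtain ⟨s, h₀, h₂, hs, hmin, h⟩ := exists_collapse_eq hclosed hx
    have hle (t : ℝ) (k : {k // g k v < 0}) :
        g k (x + t • v) ≤ c k ↔ G (some k) x - C (some k) ≤ t := by
      have hk : 0 < -g k v := neg_pos.2 k.2
      simp only [G, C, Option.elim_some, smul_apply, smul_eq_mul, map_add,
        map_smul]
      rw [← mul_sub, inv_mul_le_iff₀ hk]
      constructor <;> intro <;> linarith
    have hjs : G j x - C j ≤ s := by
      rcases j with _ | j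
      · simpa [G, C] using h₀
      · exact (hle s j).1 ((hPe ▸ hs : x + s • v ∈ {x | ∀ k, g k x ≤ c k}) j)
    have hj' (k : κ) : G k x - C k ≤ G j x - C j := by
      have := hj k
      rw [sub_apply] at this
      linarith
    have hsj : s ≤ G j x - C j := by
      refine hmin _ (by simpa [G, C] using hj' none) ?_
      rw [hPe] at hs ⊢
      intro k
      by_cases hk : g k v < 0
      · exact (hle _ ⟨k, hk⟩).2 (hj' (some ⟨k, hk⟩))
      -- Here `g k v ≥ 0`, so stopping no later than `s` (by `hjs`) keeps the constraint satisfied.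
      · refine le_trans ?_ (hs k)
        simp only [map_add, map_smul, smul_eq_mul]
        gcongr
        exact not_lt.1 hk
    have hs' : s = G j x - C j := le_antisymm hsj hjs
    rw [h, hs']
    simp [sub_smul, add_sub_assoc]

theorem isPLRetraction_collapse [FiniteDimensional ℝ E] {P : Set E} (hP : IsPolyhedralSet P)
    (v : E) :
    IsPLRetraction (collapse (P + {-v}) v) (P + segment ℝ (-(2 : ℝ) • v) 0) P where
  subset := subset_add_segment_neg_two_smul P v
  mapsTo p hp := by
    obtain ⟨s, -, -, hs, -, h⟩ := exists_collapse_eq hP.isClosed hp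
    rwa [h]
  fixes z hz := collapse_add_singleton_of_mem hP.isClosed hz
  piecewiseLinear := isPiecewiseLinearOn_collapse hP v

/-- If `φ v ≥ 0`, moving along `v` does not lower `φ`, and maximal points of `P` stay maximal in the
sum and are fixed. If `φ v < 0`, the maximal face of the sum is that of `P` shifted by `-2v`, and
its points travel the full distance back. -/
theorem collapse_image_toExposed {P : Set E} (hP : IsClosed P) (v : E) (φ : StrongDual ℝ E) :
    collapse (P + {-v}) v '' φ.toExposed (P + segment ℝ (-(2 : ℝ) • v) 0) = φ.toExposed P := by
  apply Set.Subset.antisymm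
  · rintro _ ⟨p, ⟨hp, hmax⟩, rfl⟩
    obtain ⟨s, h₀, h₂, hs, -, h⟩ := exists_collapse_eq hP hp
    rw [h]
    refine ⟨hs, fun z hz => ?_⟩
    rw [map_add, map_smul, smul_eq_mul]
    rcases le_total 0 (φ v) with hv | hv
    · have := hmax z (subset_add_segment_neg_two_smul P v hz)
      linarith [mul_nonneg h₀ hv]
    · have := hmax (z - (2 : ℝ) • v)
        (mem_add_segment_neg_two_smul.2 ⟨2, by norm_num, le_rfl, by simpa using hz⟩)
      rw [map_sub, map_smul, smul_eq_mul] at this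
      linarith [mul_le_mul_of_nonpos_right h₂ hv]
  · rintro q ⟨hq, hmax⟩
    rcases le_or_gt 0 (φ v) with hv | hv
    · refine ⟨q, ⟨subset_add_segment_neg_two_smul P v hq, fun z hz => ?_⟩,
        collapse_add_singleton_of_mem hP hq⟩
      obtain ⟨s, h₀, -, hs⟩ := mem_add_segment_neg_two_smul.1 hz
      have := hmax _ hs
      rw [map_add, map_smul, smul_eq_mul] at this
      linarith [mul_nonneg h₀ hv]
    · have hmem : q - (2 : ℝ) • v ∈ P + segment ℝ (-(2 : ℝ) • v) 0 :=
        mem_add_segment_neg_two_smul.2 ⟨2, by norm_num, le_rfl, by simpa using hq⟩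
      refine ⟨q - (2 : ℝ) • v, ⟨hmem, fun z hz => ?_⟩, ?_⟩
      · obtain ⟨s, -, h₂, hs⟩ := mem_add_segment_neg_two_smul.1 hz
        have := hmax _ hs
        rw [map_add, map_smul, smul_eq_mul] at this
        rw [map_sub, map_smul, smul_eq_mul]
        linarith [mul_le_mul_of_nonpos_right h₂ hv.le]
      · obtain ⟨s, -, h₂, hs, -, h⟩ := exists_collapse_eq hP hmem
        -- Stopping before `2` would reach a point of `P` with a value of `φ` above the maximum `φ
        -- q`.
        have h₂' : 2 ≤ s := by
          have := hmax _ hs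
          simp only [map_add, map_sub, map_smul, smul_eq_mul] at this
          nlinarith
        rw [h, le_antisymm h₂ h₂', sub_add_cancel]

theorem isPLRetraction_collapseList [FiniteDimensional ℝ E] (l : List E) {P : Set E}
    (hP : IsPolyhedralSet P) :
    IsPLRetraction (collapseList P l)
      (P + (l.map fun v => segment ℝ (-(2 : ℝ) • v) 0).sum) P := by
  induction l generalizing P with
  | nil =>
    simp only [List.map_nil, List.sum_nil, add_zero, collapseList]
    exact ⟨subset_rfl, Set.mapsTo_id P, fun _ _ => rfl,
      .of_finite (fun _ : Unit => P) (fun _ => hP) (Set.iUnion_const P).symm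
        fun _ => ⟨AffineMap.id ℝ E, fun _ _ => rfl⟩⟩
  | cons v l ih =>
    rw [List.map_cons, List.sum_cons, ← add_assoc, collapseList]
    exact (isPLRetraction_collapse hP v).comp (ih (hP.add_segment _ _))

theorem collapseList_image_toExposed (l : List E) {P : Set E} (hP : IsPolyhedralSet P)
    (φ : StrongDual ℝ E) :
    collapseList P l '' φ.toExposed (P + (l.map fun v => segment ℝ (-(2 : ℝ) • v) 0).sum)
      = φ.toExposed P := by
  induction l generalizing P with
  | nil => simp [collapseList]
  | cons v l ih =>
    rw [List.map_cons, List.sum_cons, ← add_assoc, collapseList, Set.image_comp,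
      ih (hP.add_segment _ _), collapse_image_toExposed hP.isClosed]

end Collapse

/-! ### Exposed faces of Minkowski sums and of segments -/

section Exposed

variable {E : Type*} [NormedAddCommGroup E] [NormedSpace ℝ E]

theorem StrongDual.toExposed_add (φ : StrongDual ℝ E) (P Q : Set E) :
    φ.toExposed (P + Q) = φ.toExposed P + φ.toExposed Q := by
  apply Set.Subset.antisymm
  · rintro _ ⟨⟨p, hp, q, hq, rfl⟩, hmax⟩
    refine ⟨p, ⟨hp, fun p' hp' => ?_⟩, q, ⟨hq, fun q' hq' => ?_⟩, rfl⟩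
    · simpa using hmax _ (Set.add_mem_add hp' hq)
    · simpa using hmax _ (Set.add_mem_add hp hq')
  · rintro _ ⟨p, ⟨hp, hpm⟩, q, ⟨hq, hqm⟩, rfl⟩
    refine ⟨Set.add_mem_add hp hq, ?_⟩
    rintro _ ⟨p', hp', q', hq', rfl⟩
    simpa using add_le_add (hpm p' hp') (hqm q' hq')

theorem StrongDual.toExposed_singleton (φ : StrongDual ℝ E) (z : E) :
    φ.toExposed {z} = {z} := by
  ext x
  simp only [ContinuousLinearMap.toExposed, Set.mem_ofPred_eq, Set.mem_singleton_iff]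
  constructor
  · exact And.left
  · rintro rfl
    simp

theorem StrongDual.toExposed_sum {κ : Type*} (φ : StrongDual ℝ E) (s : Finset κ)
    (P : κ → Set E) : φ.toExposed (∑ i ∈ s, P i) = ∑ i ∈ s, φ.toExposed (P i) := by
  classical
  induction s using Finset.induction_on with
  | empty =>
    simp only [Finset.sum_empty, ← Set.singleton_zero]
    exact φ.toExposed_singleton 0
  | insert i s hi ih => rw [Finset.sum_insert hi, Finset.sum_insert hi, φ.toExposed_add, ih]

/-- The face `{σ f}` (for `σ ≠ 0`) or `[-f, f]` (for `σ = 0`) of the segment `[-f, f]`. -/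
def signSegment (σ : SignType) (f : E) : Set E :=
  if σ = 0 then segment ℝ (-f) f else {(σ : ℝ) • f}

theorem StrongDual.toExposed_segment_neg (φ : StrongDual ℝ E) (f : E) :
    φ.toExposed (segment ℝ (-f) f) = signSegment (SignType.sign (φ f)) f := by
  have hseg : segment ℝ (-f) f = (fun t : ℝ => t • f) '' Set.Icc (-1) 1 := by
    have := image_segment ℝ (LinearMap.toSpanSingleton ℝ E f).toAffineMap (-1) 1
    rw [segment_eq_Icc (by norm_num)] at this
    simpa using this.symm
  ext z
  simp only [ContinuousLinearMap.toExposed, Set.mem_ofPred_eq]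
  rw [signSegment]
  rcases lt_trichotomy (φ f) 0 with h | h | h
  · rw [sign_neg h, if_neg (by decide), hseg]
    simp only [Set.forall_mem_image, Set.mem_singleton_iff, map_smul, smul_eq_mul]
    constructor
    · rintro ⟨⟨t, ⟨h₁, h₂⟩, rfl⟩, hmax⟩
      have := hmax (x := -1) (by simp)
      have : t = -1 := by
        simp only [map_smul, smul_eq_mul] at this
        nlinarith
      simp [this]
    · rintro rfl
      refine ⟨⟨-1, by simp, by simp⟩, fun t ht => ?_⟩
      simp only [SignType.coe_neg_one, map_smul, smul_eq_mul]
      nlinarith [ht.1]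
  · rw [h, sign_zero, if_pos rfl, hseg]
    simp only [Set.forall_mem_image, map_smul, smul_eq_mul, h, mul_zero, and_iff_left_iff_imp]
    rintro ⟨t, -, rfl⟩ t' -
    simp [h]
  · rw [sign_pos h, if_neg (by decide), hseg]
    simp only [Set.forall_mem_image, Set.mem_singleton_iff, map_smul, smul_eq_mul]
    constructor
    · rintro ⟨⟨t, ⟨h₁, h₂⟩, rfl⟩, hmax⟩
      have := hmax (x := 1) (by simp)
      have : t = 1 := by
        simp only [map_smul, smul_eq_mul] at this
        nlinarith
      simp [this]
    · rintro rfl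
      refine ⟨⟨1, by simp, by simp⟩, fun t ht => ?_⟩
      simp only [SignType.coe_one, map_smul, smul_eq_mul]
      nlinarith [ht.2]

/-- The source of the face product: a point is its own maximal face, so a nonzero sign persists,
while a full segment takes the sign of `φ f`. -/
theorem StrongDual.toExposed_signSegment (φ : StrongDual ℝ E) (σ : SignType) (f : E) :
    φ.toExposed (signSegment σ f)
      = signSegment (if σ ≠ 0 then σ else SignType.sign (φ f)) f := by
  by_cases h : σ = 0
  · simp only [h, ne_eq, not_true_eq_false, if_false]
    rw [← φ.toExposed_segment_neg, signSegment, if_pos rfl]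
  · simp only [signSegment, h, ne_eq, not_false_eq_true, if_true, if_false]
    exact φ.toExposed_singleton _

theorem signSegment_add_segment {σ : SignType} (hσ : σ ≠ 0) (f : E) :
    signSegment σ f + segment ℝ (-(2 : ℝ) • (σ : ℝ) • f) 0 = segment ℝ (-f) f := by
  rw [signSegment, if_neg hσ, Set.singleton_add]
  have := image_segment ℝ (AffineEquiv.constVAdd ℝ E ((σ : ℝ) • f)).toAffineMap
    (-(2 : ℝ) • (σ : ℝ) • f) 0
  simp only [AffineEquiv.coe_toAffineMap, AffineEquiv.constVAdd_apply, vadd_eq_add] at this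
  rw [this]
  cases σ
  · exact absurd rfl hσ
  · rw [segment_symm]
    congr 1 <;> simp [two_smul]
  · congr 1 <;> simp [two_smul]

end Exposed

/-! ### Faces of the zonotope -/

namespace RealArrangement

variable {ι W : Type*} [Fintype ι] [NormedAddCommGroup W] [NormedSpace ℝ W]
  {A : RealArrangement ι W}

theorem Face.toExposed_zonotope (F : A.Face) {x : W} (hx : x ∈ F.carrier) :
    (ContinuousLinearMap.apply ℝ ℝ x).toExposed A.zonotope
      = ∑ i, signSegment (F.sign i) (A.form i) := by
  rw [zonotope, StrongDual.toExposed_sum]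
  refine Finset.sum_congr rfl fun i _ => ?_
  rw [StrongDual.toExposed_segment_neg, ← hx i, ContinuousLinearMap.apply_apply]

/-- The maximal face depends only on the signs of `x`, so a single point of `F` determines it. -/
theorem Face.hat_eq_toExposed (F : A.Face) {x : W} (hx : x ∈ F.carrier) :
    F.hat = (ContinuousLinearMap.apply ℝ ℝ x).toExposed A.zonotope := by
  ext z
  constructor
  · exact fun hz => ⟨hz.1, hz.2 x hx⟩
  · intro hz
    refine ⟨hz.1, fun y hy => ?_⟩
    rw [F.toExposed_zonotope hx, ← F.toExposed_zonotope hy] at hz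
    exact hz.2

theorem Face.hat_eq_sum (F : A.Face) : F.hat = ∑ i, signSegment (F.sign i) (A.form i) := by
  obtain ⟨x, hx⟩ := F.realized
  rw [F.hat_eq_toExposed hx, F.toExposed_zonotope hx]

theorem Face.base_eq_hat (F : A.Face) : F.base = F.hat := by
  rw [F.hat_eq_sum, base, ← Finset.sum_filter_add_sum_filter_not Finset.univ (F.sign · = 0)
    fun i => signSegment (F.sign i) (A.form i), add_comm]
  refine congrArg₂ (· + ·) (Finset.sum_congr rfl fun i hi => ?_) ?_
  · rw [signSegment, if_pos (Finset.mem_filter.1 hi).2]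
  · have h : ∑ i, F.signedForm i = ∑ i with ¬F.sign i = 0, F.signedForm i := by
      refine (Finset.sum_filter_of_ne (p := fun i => ¬F.sign i = 0) fun i _ hi h0 => hi ?_).symm
      simp [signedForm, h0]
    rw [h, ← Set.singletonAddMonoidHom_apply, map_sum]
    refine Finset.sum_congr rfl fun i hi => ?_
    rw [signSegment, if_neg (Finset.mem_filter.1 hi).2]
    rfl

theorem Face.isPolyhedralSet_base [FiniteDimensional ℝ W] (F : A.Face) :
    IsPolyhedralSet F.base := by
  classical
  rw [base]
  generalize Finset.univ.filter (F.sign · = 0) = s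
  induction s using Finset.induction_on with
  | empty => simpa using IsPolyhedralSet.singleton (∑ i, F.signedForm i)
  | insert i s hi ih =>
    rw [Finset.sum_insert hi, add_comm (segment _ _ _), ← add_assoc]
    exact ih.add_segment _ _

/-- For each `i` with `F.sign i ≠ 0`, adding `[-2 F_i f_i, 0]` to the vertex `F_i f_i` restores the
whole segment `[-f_i, f_i]`. -/
theorem Face.base_add_sum (F : A.Face) {l : List ι} (hl : l.Nodup)
    (h : ∀ i, i ∈ l ↔ F.sign i ≠ 0) :
    F.base + ((l.map F.signedForm).map fun v => segment ℝ (-(2 : ℝ) • v) 0).sum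
      = A.zonotope := by
  classical
  rw [List.map_map, ← List.sum_toFinset (M := Set (StrongDual ℝ W)) _ hl, F.base_eq_hat, F.hat_eq_sum, zonotope,
    ← Finset.sum_filter_add_sum_filter_not Finset.univ (F.sign · = 0) fun i =>
      segment ℝ (-A.form i) (A.form i),
    ← Finset.sum_filter_add_sum_filter_not Finset.univ (F.sign · = 0) fun i =>
      signSegment (F.sign i) (A.form i)]
  have hl' : l.toFinset = Finset.univ.filter fun i => ¬F.sign i = 0 := by
    ext i
    simp [h]
  rw [hl', add_assoc, ← Finset.sum_add_distrib]
  refine congrArg₂ (· + ·) (Finset.sum_congr rfl fun i hi => ?_)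
    (Finset.sum_congr rfl fun i hi => ?_)
  · rw [signSegment, if_pos (Finset.mem_filter.1 hi).2]
  · exact signSegment_add_segment (Finset.mem_filter.1 hi).2 (A.form i)

theorem Face.toExposed_base (F G : A.Face) {y : W} (hy : y ∈ G.carrier) :
    (ContinuousLinearMap.apply ℝ ℝ y).toExposed F.base = (F * G).hat := by
  rw [F.base_eq_hat, F.hat_eq_sum, StrongDual.toExposed_sum, (F * G).hat_eq_sum]
  refine Finset.sum_congr rfl fun i _ => ?_
  rw [StrongDual.toExposed_signSegment, ContinuousLinearMap.apply_apply, hy i]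
  rfl

end RealArrangement

theorem proposition2p2 {ι W : Type*} [Fintype ι] [NormedAddCommGroup W] [NormedSpace ℝ W]
    [FiniteDimensional ℝ W] (A : RealArrangement ι W) (F : A.Face) :
    (∃ p : StrongDual ℝ W → StrongDual ℝ W,
      IsPLRetraction p A.zonotope F.hat ∧ ∀ G : A.Face, p '' G.hat = (F * G).hat) ∧
    ∀ l : List ι, l.Nodup → (∀ i, i ∈ l ↔ F.sign i ≠ 0) →
      IsPLRetraction (collapseList F.base (l.map F.signedForm)) A.zonotope F.hat ∧
      ∀ G : A.Face, collapseList F.base (l.map F.signedForm) '' G.hat = (F * G).hat := by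
  have main (l : List ι) (hl : l.Nodup) (h : ∀ i, i ∈ l ↔ F.sign i ≠ 0) :
      IsPLRetraction (collapseList F.base (l.map F.signedForm)) A.zonotope F.hat ∧
      ∀ G : A.Face, collapseList F.base (l.map F.signedForm) '' G.hat = (F * G).hat := by
    rw [← F.base_eq_hat, ← F.base_add_sum hl h]
    refine ⟨isPLRetraction_collapseList _ F.isPolyhedralSet_base, fun G => ?_⟩
    obtain ⟨y, hy⟩ := G.realized
    rw [G.hat_eq_toExposed hy, ← F.base_add_sum hl h,
      collapseList_image_toExposed _ F.isPolyhedralSet_base, F.toExposed_base G hy]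
  -- Existence needs only some enumeration of the hyperplanes not containing `F`.
  exact ⟨⟨_, main (Finset.univ.filter (F.sign · ≠ 0)).toList (Finset.nodup_toList _)
    (by simp)⟩, main⟩
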